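/- For discrete distributions $p,q$ on $[n]=\{1,\dots,n\}$ let $\|p\|_2=\bigl(\sum_i p_i^2\bigr)^{1/2}$ and let $$\|p-q\|_{\mathcal A_k}=\max_{(I_1,\dots,I_k)}\ \sum_{i=1}^k |p(I_i)-q(I_i)|,$$ where the maximum is over all partitions of $[n]$ into $k$ intervals. For every constant $B$ there is a constant $C>0$, depending only on $B$, such that the following holds for all integers $2\le k\le n$ and all reals $\epsilon>0$ and $0<\delta<1$. There is a (possibly randomized) testing algorithm, depending only on $B,n,k,\epsilon,\delta$, that draws at most $C\,\frac{\sqrt k}{\epsilon^2}\,\log(1/\delta)$ independent samples from each of two unknown distributions $p,q$ on $[n]$ and answers YES or NO, such that whenever $\|p\|_2,\|q\|_2\le B/\sqrt n$: - if $p=q$, it answers YES with probability at least $1-\delta$; - if $\|p-q\|_{\mathcal A_k}>\epsilon$, it answers NO with probability at least $1-\delta$. -/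

import Mathlib

open scoped BigOperators

noncomputable section

namespace AkTesting

/-- The `L₂` norm `‖p‖₂ = √(∑ pᵢ²)` of a vector indexed by `[n]`. -/
def l2Norm {n : ℕ} (p : Fin n → ℝ) : ℝ :=
  √(∑ i, p i ^ 2)

/-- The mass `p(S) = ∑_{i ∈ S} pᵢ`. -/
def mass {n : ℕ} (p : Fin n → ℝ) (S : Finset (Fin n)) : ℝ :=
  ∑ i ∈ S, p i

/-- `I = (I₁, …, I_k)` is a partition of `[n]` into `k` disjoint intervals. Empty intervals are
allowed; as refining a partition never decreases `∑ |p(Iᵢ) - q(Iᵢ)|`, for `1 ≤ k ≤ n` this does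
not change the maximum that defines the `A_k`-distance. -/
structure IsIntervalPartition {n k : ℕ} (I : Fin k → Finset (Fin n)) : Prop where
  interval : ∀ j, (I j : Set (Fin n)).OrdConnected
  disjoint : ∀ j j', j ≠ j' → Disjoint (I j) (I j')
  cover : ∀ x, ∃ j, x ∈ I j

/-- The `A_k`-distance: the maximum of `∑ᵢ |p(Iᵢ) - q(Iᵢ)|` over all partitions of `[n]` into `k`
intervals. (There are finitely many partitions, and at least one if `k ≥ 1`.) -/
def akDist {n : ℕ} (k : ℕ) (p q : Fin n → ℝ) : ℝ :=
  ⨆ I : {I : Fin k → Finset (Fin n) // IsIntervalPartition I},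
    ∑ j, |mass p (I.1 j) - mass q (I.1 j)|

/-- A (possibly randomized) tester that sees `m` samples `x` from the first distribution and `m`
samples `y` from the second one: `T x y` is the conditional probability, over the internal
randomness of the tester, that it answers "YES" on these samples; it answers "NO" otherwise. -/
abbrev Tester (n m : ℕ) : Type :=
  (Fin m → Fin n) → (Fin m → Fin n) → unitInterval

/-- The probability that `m` independent samples from `p` are `x₁, …, x_m`. -/
def sampleProb {n m : ℕ} (p : Fin n → ℝ) (x : Fin m → Fin n) : ℝ :=
  ∏ i, p (x i)

/-- The probability that `T` answers "YES" when it is given `m` independent samples from `p` and,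
independently of them, `m` independent samples from `q`. -/
def probYes {n m : ℕ} (T : Tester n m) (p q : Fin n → ℝ) : ℝ :=
  ∑ x : Fin m → Fin n, ∑ y : Fin m → Fin n, sampleProb p x * sampleProb q y * (T x y : ℝ)

/-- The probability that `T` answers "NO" in the same experiment. -/
def probNo {n m : ℕ} (T : Tester n m) (p q : Fin n → ℝ) : ℝ :=
  ∑ x : Fin m → Fin n, ∑ y : Fin m → Fin n, sampleProb p x * sampleProb q y * (1 - (T x y : ℝ))

end AkTesting

end

/-! The `A_k`-distance is controlled by a quadratic form in `r = p - q` that two independent batches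
of samples estimate well. Cut `[n]` into blocks of length `16 ^ i` for `i ≤ J`, where `16 ^ J` is
within a factor 16 of `n / k`, and let `energy` be the sum of the squared block masses of `r`, with
weight `2 ^ (J - i)` at level `i`.

Lower bound (`sq_sum_abs_le_energy`): an interval partition yields a sign function `F` with `∑
|r(I_j)| = ∑ r F`. Replacing `F` by its values at left ends of blocks and telescoping over the
levels leaves at most `16 k` active blocks per level, because few blocks contain the start of an
interval. Cauchy–Schwarz on each level, then across levels, gives `(∑ |r(I_j)|)² ≤ 128 k * energy`.

Variance (`sum_pairStat_sub_sq_le`, `sum_blockKernel_sq_le`): `energy` is the squared norm of the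
mean of a feature vector, so the inner product of the feature sums of two independent batches
estimates it without bias up to the factor `m²`. Its variance depends only on the mean and the
second moment of the kernel, which the `L₂` hypothesis bounds by `O(B² / k)`. The block ratio 16 and
weight ratio 2 make both sums over levels geometric, so no factor `log (n / k)` is lost.

Chebyshev's inequality then gives a test with error at most 1/6 from `O(√k / ε²)` samples
(`pairStat_test`), and a majority vote over `O(log (1 / δ))` runs reduces the error to `δ`. -/

namespace AkTesting

/-! ### Moments under a product distribution -/

/-- The probability of a tuple of independent draws, each distributed according to `w`. -/
noncomputable def prodWeight {ι Ω : Type*} [Fintype ι] (w : Ω → ℝ) (z : ι → Ω) : ℝ :=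
  ∏ i, w (z i)

theorem prodWeight_nonneg {ι Ω : Type*} [Fintype ι] {w : Ω → ℝ} (hw : ∀ a, 0 ≤ w a)
    (z : ι → Ω) : 0 ≤ prodWeight w z :=
  Finset.prod_nonneg fun _ _ => hw _

/-- Expectations of products factor over independent coordinates. The moments below take `f` to be 1
off one or two coordinates; the majority bound takes the same exponential factor at every
coordinate. -/
theorem sum_prodWeight_mul_prod {ι Ω : Type*} [Fintype ι] [DecidableEq ι] [Fintype Ω]
    (w : Ω → ℝ) (f : ι → Ω → ℝ) :
    ∑ z : ι → Ω, prodWeight w z * ∏ i, f i (z i) = ∏ i, ∑ a, w a * f i a := by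
  simp only [prodWeight, ← Finset.prod_mul_distrib]
  rw [Finset.prod_univ_sum, Fintype.piFinset_univ]

theorem sum_prodWeight {ι Ω : Type*} [Fintype ι] [DecidableEq ι] [Fintype Ω]
    {w : Ω → ℝ} (hw : ∑ a, w a = 1) :
    ∑ z : ι → Ω, prodWeight w z = 1 := by
  have h := sum_prodWeight_mul_prod (ι := ι) w fun _ _ => 1
  simpa [hw] using h

theorem sum_prodWeight_mul_apply {ι Ω : Type*} [Fintype ι] [DecidableEq ι] [Fintype Ω]
    {w : Ω → ℝ} (hw : ∑ a, w a = 1) (f : Ω → ℝ) (i : ι) :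
    ∑ z : ι → Ω, prodWeight w z * f (z i) = ∑ a, w a * f a := by
  have h := sum_prodWeight_mul_prod (ι := ι) w fun l a => if l = i then f a else 1
  have e1 : ∀ z : ι → Ω, (∏ l, if l = i then f (z l) else 1) = f (z i) := fun z => by
    simp [Finset.prod_ite_eq']
  have e2 : ∀ l : ι, (∑ a, w a * (if l = i then f a else 1)) =
      if l = i then ∑ a, w a * f a else 1 := fun l => by
    split_ifs <;> simp [hw]
  simp only [e1, e2] at h
  simpa using h

theorem sum_prodWeight_mul_apply_mul_apply {ι Ω : Type*} [Fintype ι] [DecidableEq ι] [Fintype Ω]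
    {w : Ω → ℝ} (hw : ∑ a, w a = 1) (f g : Ω → ℝ) {i j : ι} (hij : i ≠ j) :
    ∑ z : ι → Ω, prodWeight w z * (f (z i) * g (z j)) =
      (∑ a, w a * f a) * ∑ a, w a * g a := by
  have h := sum_prodWeight_mul_prod (ι := ι) w
    fun l a => (if l = i then f a else 1) * (if l = j then g a else 1)
  have e1 : ∀ z : ι → Ω, (∏ l, (if l = i then f (z l) else 1) * (if l = j then g (z l) else 1)) =
      f (z i) * g (z j) := fun z => by
    rw [Finset.prod_mul_distrib]
    simp
  have e2 : ∀ l : ι, (∑ a, w a * ((if l = i then f a else 1) * (if l = j then g a else 1))) =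
      (if l = i then ∑ a, w a * f a else 1) * (if l = j then ∑ a, w a * g a else 1) := fun l => by
    by_cases h1 : l = i
    · subst h1
      simp [hij]
    · by_cases h2 : l = j
      · subst h2
        simp [h1]
      · simp [h1, h2, hw]
  simp only [e1, e2] at h
  rw [h, Finset.prod_mul_distrib]
  simp

/-- Second moments of a sum of `m` independent copies. -/
theorem sum_prodWeight_mul_sum_mul_sum {Ω : Type*} [Fintype Ω] {m : ℕ}
    {w : Ω → ℝ} (hw : ∑ a, w a = 1) (f g : Ω → ℝ) :
    ∑ z : Fin m → Ω, prodWeight w z * ((∑ i, f (z i)) * ∑ i, g (z i)) =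
      m * ∑ a, w a * (f a * g a) + m * (m - 1) * ((∑ a, w a * f a) * ∑ a, w a * g a) := by
  have e : ∀ i j : Fin m, ∑ z : Fin m → Ω, prodWeight w z * (f (z i) * g (z j)) =
      (if i = j then ∑ a, w a * (f a * g a) - (∑ a, w a * f a) * ∑ a, w a * g a else 0) +
        (∑ a, w a * f a) * ∑ a, w a * g a := fun i j => by
    split_ifs with h
    · subst h
      rw [sum_prodWeight_mul_apply hw (fun a => f a * g a) i]
      ring
    · rw [sum_prodWeight_mul_apply_mul_apply hw f g h, zero_add]
  have e' : ∀ z : Fin m → Ω, prodWeight w z * ((∑ i, f (z i)) * ∑ i, g (z i)) =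
      ∑ i, ∑ j, prodWeight w z * (f (z i) * g (z j)) := fun z => by
    rw [Finset.sum_mul_sum]
    simp only [Finset.mul_sum]
  simp_rw [e', Finset.sum_comm (s := (Finset.univ : Finset (Fin m → Ω)))
    (t := (Finset.univ : Finset (Fin m))), e]
  simp only [Finset.sum_add_distrib, Finset.sum_ite_eq, Finset.mem_univ, if_true,
    Finset.sum_const, Finset.card_univ, Fintype.card_fin, nsmul_eq_mul]
  ring

theorem sum_prodWeight_mul_sum {Ω : Type*} [Fintype Ω] {m : ℕ}
    {w : Ω → ℝ} (hw : ∑ a, w a = 1) (f : Ω → ℝ) :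
    ∑ z : Fin m → Ω, prodWeight w z * ∑ i, f (z i) = m * ∑ a, w a * f a := by
  simp only [Finset.mul_sum (Finset.univ : Finset (Fin m)) _ (prodWeight w _)]
  rw [Finset.sum_comm]
  simp [sum_prodWeight_mul_apply hw]

/-! ### The bilinear statistic and its variance -/

/-- The bilinear statistic `⟨∑ v(zᵢ), ∑ v(z'ᵢ)⟩` of two samples. -/
noncomputable def pairStat {Ω S : Type*} [Fintype S] {m : ℕ} (v : Ω → S → ℝ) (z z' : Fin m → Ω) : ℝ :=
  ∑ s, (∑ i, v (z i) s) * ∑ i, v (z' i) s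

/-- The mean of the feature vector `v`. -/
noncomputable def meanVec {Ω S : Type*} [Fintype Ω] (w : Ω → ℝ) (v : Ω → S → ℝ) (s : S) : ℝ :=
  ∑ a, w a * v a s

theorem sum_sq_first_moment {Ω S : Type*} [Fintype Ω] [Fintype S] (w : Ω → ℝ)
    (v : Ω → S → ℝ) :
    ∑ s, (∑ a, w a * v a s) ^ 2 = ∑ a, ∑ b, w a * w b * ∑ s, v a s * v b s := by
  simp only [sq, Finset.sum_mul_sum]
  simp only [Finset.mul_sum]
  rw [Finset.sum_comm]
  refine Finset.sum_congr rfl fun a _ => ?_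
  rw [Finset.sum_comm]
  refine Finset.sum_congr rfl fun b _ => Finset.sum_congr rfl fun s _ => by ring

/-- This is the first-moment identity applied to the tensor square of `v`, indexed by `S × S`. -/
theorem sum_sq_second_moment {Ω S : Type*} [Fintype Ω] [Fintype S] (w : Ω → ℝ)
    (v : Ω → S → ℝ) :
    ∑ s, ∑ t, (∑ a, w a * (v a s * v a t)) ^ 2 =
      ∑ a, ∑ b, w a * w b * (∑ s, v a s * v b s) ^ 2 := by
  have h := sum_sq_first_moment w fun a (s : S × S) => v a s.1 * v a s.2
  simp only [Fintype.sum_prod_type] at h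
  rw [h]
  refine Finset.sum_congr rfl fun a _ => Finset.sum_congr rfl fun b _ => ?_
  rw [sq, Finset.sum_mul_sum]
  congr 1
  refine Finset.sum_congr rfl fun s _ => Finset.sum_congr rfl fun t _ => by ring

theorem sum_pairStat {Ω S : Type*} [Fintype Ω] [Fintype S] {m : ℕ} {w : Ω → ℝ}
    (hw : ∑ a, w a = 1) (v : Ω → S → ℝ) :
    ∑ z : Fin m → Ω, ∑ z' : Fin m → Ω, prodWeight w z * prodWeight w z' * pairStat v z z' =
      m ^ 2 * ∑ s, meanVec w v s ^ 2 := by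
  have h := sum_sq_first_moment (prodWeight w) fun (z : Fin m → Ω) s => ∑ i, v (z i) s
  simp only [pairStat]
  rw [← h, Finset.mul_sum]
  refine Finset.sum_congr rfl fun s _ => ?_
  rw [sum_prodWeight_mul_sum hw fun a => v a s, mul_pow, meanVec]

/-- A whole batch is treated as a single random point whose feature vector is the sum over the
batch; its second moment matrix is then a combination of that of `v` and the rank-one matrix of the
mean. -/
theorem sum_pairStat_sq {Ω S : Type*} [Fintype Ω] [Fintype S] {m : ℕ} {w : Ω → ℝ}
    (hw : ∑ a, w a = 1) (v : Ω → S → ℝ) :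
    ∑ z : Fin m → Ω, ∑ z' : Fin m → Ω, prodWeight w z * prodWeight w z' * pairStat v z z' ^ 2 =
      ∑ s, ∑ t, (m * ∑ a, w a * (v a s * v a t) +
        m * (m - 1) * (meanVec w v s * meanVec w v t)) ^ 2 := by
  have h := sum_sq_second_moment (prodWeight w) fun (z : Fin m → Ω) s => ∑ i, v (z i) s
  simp only [pairStat]
  rw [← h]
  refine Finset.sum_congr rfl fun s _ => Finset.sum_congr rfl fun t _ => ?_
  rw [sum_prodWeight_mul_sum_mul_sum hw (fun a => v a s) fun a => v a t]
  rfl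

/-- Variance bound for the bilinear statistic, in terms of a bound `F` for the Frobenius norm of
the second moment matrix. -/
theorem sum_pairStat_sub_sq_le {Ω S : Type*} [Fintype Ω] [Fintype S] {m : ℕ} {w : Ω → ℝ}
    (hw : ∑ a, w a = 1) (v : Ω → S → ℝ) {F : ℝ} (hF : 0 ≤ F)
    (hH : ∑ a, ∑ b, w a * w b * (∑ s, v a s * v b s) ^ 2 ≤ F ^ 2) :
    ∑ z : Fin m → Ω, ∑ z' : Fin m → Ω, prodWeight w z * prodWeight w z' *
        (pairStat v z z' - m ^ 2 * ∑ s, meanVec w v s ^ 2) ^ 2 ≤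
      m ^ 2 * F ^ 2 + 2 * m ^ 3 * F * ∑ s, meanVec w v s ^ 2 := by
  set M := ∑ s, meanVec w v s ^ 2 with hM
  have hM0 : 0 ≤ M := Finset.sum_nonneg fun _ _ => sq_nonneg _
  set A : S → S → ℝ := fun s t => ∑ a, w a * (v a s * v a t) with hA
  have hAF : ∑ s, ∑ t, A s t ^ 2 ≤ F ^ 2 := by
    rw [hA, sum_sq_second_moment]; exact hH
  have hMM : ∑ s, ∑ t, (meanVec w v s * meanVec w v t) ^ 2 = M ^ 2 := by
    simp only [mul_pow]
    rw [← Finset.sum_mul_sum, ← hM, sq]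
  -- Cauchy–Schwarz for the Frobenius inner product of `A` with the rank-one matrix of the mean,
  -- whose Frobenius norm is `M`.
  have hcross : ∑ s, ∑ t, A s t * (meanVec w v s * meanVec w v t) ≤ F * M := by
    have h := Finset.sum_mul_sq_le_sq_mul_sq (Finset.univ : Finset (S × S))
      (fun x => A x.1 x.2) (fun x => meanVec w v x.1 * meanVec w v x.2)
    simp only [Fintype.sum_prod_type] at h
    rw [hMM] at h
    refine abs_le_of_sq_le_sq' ?_ (by positivity) |>.2
    calc _ ≤ _ := h
      _ ≤ F ^ 2 * M ^ 2 := by gcongr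
      _ = _ := by ring
  have h1 := sum_pairStat (m := m) hw v
  have h2 := sum_pairStat_sq (m := m) hw v
  have hW : ∑ z : Fin m → Ω, ∑ z' : Fin m → Ω, prodWeight w z * prodWeight w z' = 1 := by
    rw [← Finset.sum_mul_sum, sum_prodWeight hw, one_mul]
  have e : ∑ z : Fin m → Ω, ∑ z' : Fin m → Ω, prodWeight w z * prodWeight w z' *
        (pairStat v z z' - m ^ 2 * M) ^ 2 =
      ∑ z : Fin m → Ω, ∑ z' : Fin m → Ω, prodWeight w z * prodWeight w z' * pairStat v z z' ^ 2 -
        2 * (m ^ 2 * M) * (∑ z : Fin m → Ω, ∑ z' : Fin m → Ω,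
          prodWeight w z * prodWeight w z' * pairStat v z z') +
        (m ^ 2 * M) ^ 2 * ∑ z : Fin m → Ω, ∑ z' : Fin m → Ω,
          prodWeight w z * prodWeight w z' := by
    simp only [Finset.mul_sum, ← Finset.sum_sub_distrib, ← Finset.sum_add_distrib]
    refine Finset.sum_congr rfl fun z _ => Finset.sum_congr rfl fun z' _ => by ring
  have e2 : ∑ s, ∑ t, ((m : ℝ) * A s t + m * (m - 1) * (meanVec w v s * meanVec w v t)) ^ 2 =
      m ^ 2 * ∑ s, ∑ t, A s t ^ 2 +
        2 * m ^ 2 * (m - 1) * ∑ s, ∑ t, A s t * (meanVec w v s * meanVec w v t) +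
        m ^ 2 * (m - 1) ^ 2 * ∑ s, ∑ t, (meanVec w v s * meanVec w v t) ^ 2 := by
    simp only [Finset.mul_sum, ← Finset.sum_add_distrib]
    refine Finset.sum_congr rfl fun z _ => Finset.sum_congr rfl fun z' _ => by ring
  rw [e, h1, hW, h2, e2, hMM]
  rcases Nat.eq_zero_or_pos m with rfl | hm
  · simp
  have hm1 : (1 : ℝ) ≤ m := by exact_mod_cast hm
  have b1 : (m : ℝ) ^ 2 * ∑ s, ∑ t, A s t ^ 2 ≤ m ^ 2 * F ^ 2 := by gcongr
  have b2 : 2 * (m : ℝ) ^ 2 * (m - 1) * ∑ s, ∑ t, A s t * (meanVec w v s * meanVec w v t) ≤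
      2 * m ^ 2 * (m - 1) * (F * M) := by
    have : (0 : ℝ) ≤ m - 1 := by linarith
    gcongr
  have b3 : 2 * (m : ℝ) ^ 2 * (m - 1) * (F * M) ≤ 2 * m ^ 3 * F * M := by
    have : 0 ≤ 2 * (m : ℝ) ^ 2 * (F * M) := by positivity
    nlinarith
  have b4 : (m : ℝ) ^ 2 * (m - 1) ^ 2 * M ^ 2 ≤ (m ^ 2 * M) ^ 2 := by
    have : ((m : ℝ) - 1) ^ 2 ≤ m ^ 2 := by nlinarith
    calc _ ≤ (m : ℝ) ^ 2 * m ^ 2 * M ^ 2 := by gcongr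
      _ = _ := by ring
  nlinarith

/-! ### Chebyshev's inequality and majority votes -/

/-- Chebyshev's inequality for a finite weighted sum. -/
theorem sum_ite_le_of_sum_sq_le {Ω : Type*} [Fintype Ω] {w f : Ω → ℝ} (hw : ∀ a, 0 ≤ w a)
    {c : ℝ} {L : ℝ} (hL : 0 < L) (P : Ω → Prop) [DecidablePred P]
    (hP : ∀ a, P a → L ≤ (f a - c) ^ 2) :
    ∑ a, w a * (if P a then 1 else 0) ≤ (∑ a, w a * (f a - c) ^ 2) / L := by
  rw [le_div_iff₀ hL, Finset.sum_mul]
  refine Finset.sum_le_sum fun a _ => ?_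
  split_ifs with h
  · rw [mul_one]
    exact mul_le_mul_of_nonneg_left (hP a h) (hw a)
  · rw [mul_zero, zero_mul]
    exact mul_nonneg (hw a) (sq_nonneg _)

/-- Exponentially small failure probability of a majority vote. -/
theorem sum_majority_le {Ω : Type*} [Fintype Ω] {w : Ω → ℝ} (hw : ∀ a, 0 ≤ w a)
    (hw1 : ∑ a, w a = 1) (bad : Ω → Prop) [DecidablePred bad]
    (hbad : ∑ a, w a * (if bad a then 1 else 0) ≤ 1 / 6) (N : ℕ) :
    ∑ z : Fin N → Ω, prodWeight w z *
      (if N ≤ 2 * (Finset.univ.filter fun i => bad (z i)).card then 1 else 0) ≤ (3 / 4) ^ N := by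
  -- Exponential Markov bound: when at least half the runs are bad, `4 ^ #bad ≥ 2 ^ N`. A run
  -- contributes at most `(1 + 3 / 6) / 2 = 3 / 4` in expectation.
  have key : ∀ z : Fin N → Ω,
      (if N ≤ 2 * (Finset.univ.filter fun i => bad (z i)).card then (1 : ℝ) else 0) ≤
        (1 / 2) ^ N * ∏ i, (if bad (z i) then 4 else 1) := fun z => by
    rw [Finset.prod_ite]
    simp only [Finset.prod_const, one_pow, mul_one]
    split_ifs with h
    · rw [one_div, inv_pow, inv_mul_eq_div, le_div_iff₀ (by positivity), one_mul,
        show (4 : ℝ) = 2 ^ 2 by norm_num, ← pow_mul]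
      exact pow_le_pow_right₀ (by norm_num) h
    · positivity
  calc _ ≤ ∑ z : Fin N → Ω, prodWeight w z *
        ((1 / 2) ^ N * ∏ i, (if bad (z i) then 4 else 1)) :=
        Finset.sum_le_sum fun z _ =>
          mul_le_mul_of_nonneg_left (key z) (prodWeight_nonneg hw z)
    _ = (1 / 2) ^ N * ∏ _i : Fin N, ∑ a, w a * (if bad a then 4 else 1) := by
        rw [← sum_prodWeight_mul_prod w fun (_ : Fin N) a => if bad a then (4 : ℝ) else 1,
          Finset.mul_sum]
        exact Finset.sum_congr rfl fun z _ => by ring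
    _ = ((1 / 2) * ∑ a, w a * (if bad a then 4 else 1)) ^ N := by
        rw [Finset.prod_const, Finset.card_univ, Fintype.card_fin, mul_pow]
    _ ≤ (3 / 4) ^ N := by
        have e : ∑ a, w a * (if bad a then (4 : ℝ) else 1) =
            1 + 3 * ∑ a, w a * (if bad a then 1 else 0) := by
          have h1 : (1 : ℝ) + 3 * ∑ a, w a * (if bad a then 1 else 0) =
              ∑ a, w a + 3 * ∑ a, w a * (if bad a then 1 else 0) := by rw [hw1]
          rw [h1, Finset.mul_sum, ← Finset.sum_add_distrib]
          refine Finset.sum_congr rfl fun a _ => ?_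
          split_ifs <;> ring
        have h0 : 0 ≤ ∑ a, w a * (if bad a then (4 : ℝ) else 1) :=
          Finset.sum_nonneg fun a _ => mul_nonneg (hw a) (by split_ifs <;> norm_num)
        refine pow_le_pow_left₀ (by positivity) ?_ N
        linarith

/-! ### Multiscale energy and the `A_k`-distance -/

/-- The mass of the vector `r` on the `u`-th block of length `b`. -/
noncomputable def blockMass {n : ℕ} (r : Fin n → ℝ) (b u : ℕ) : ℝ :=
  ∑ x, r x * (if (x : ℕ) / b = u then 1 else 0)

/-- Cauchy–Schwarz over the active blocks: at most `16 K` of them with values at most 2 give the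
factor `√(4 * 16 K) = 8 √K`. -/
theorem sum_mul_block_le {n : ℕ} (r : Fin n → ℝ) (b K : ℕ) (g : Fin n → ℝ) (G : ℕ → ℝ)
    (hg : ∀ x : Fin n, g x = G (x / b)) (hG : ∀ u, |G u| ≤ 2) (U : Finset ℕ)
    (hU : U ⊆ Finset.range n) (hsupp : ∀ x : Fin n, g x ≠ 0 → (x : ℕ) / b ∈ U)
    (hcard : U.card ≤ 16 * K) :
    ∑ x, r x * g x ≤ 8 * √K * √(∑ u ∈ Finset.range n, blockMass r b u ^ 2) := by
  have e : ∑ x, r x * g x = ∑ u ∈ U, G u * blockMass r b u := by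
    simp only [blockMass, Finset.mul_sum]
    rw [Finset.sum_comm]
    refine Finset.sum_congr rfl fun x _ => ?_
    by_cases h : g x = 0
    · have h' : G (x / b) = 0 := by rw [← hg, h]
      rw [h, mul_zero]
      refine (Finset.sum_eq_zero fun u _ => ?_).symm
      split_ifs with hu
      · rw [← hu, h', zero_mul]
      · simp
    · rw [Finset.sum_eq_single ((x : ℕ) / b)]
      · simp [hg, mul_comm]
      · intro u _ hu
        simp [hu.symm]
      · intro hx
        exact absurd (hsupp x h) hx
  have h1 : ∑ u ∈ U, G u ^ 2 ≤ 64 * K := by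
    calc ∑ u ∈ U, G u ^ 2 ≤ ∑ u ∈ U, (4 : ℝ) := Finset.sum_le_sum fun u _ => by
          have := hG u
          rw [← sq_abs]
          nlinarith [abs_nonneg (G u)]
      _ = 4 * U.card := by rw [Finset.sum_const, nsmul_eq_mul, mul_comm]
      _ ≤ 4 * ((16 * K : ℕ) : ℝ) := by gcongr
      _ = 64 * K := by push_cast; ring
  have h2 : ∑ u ∈ U, blockMass r b u ^ 2 ≤ ∑ u ∈ Finset.range n, blockMass r b u ^ 2 :=
    Finset.sum_le_sum_of_subset_of_nonneg hU fun _ _ _ => sq_nonneg _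
  rw [e]
  refine abs_le_of_sq_le_sq' ?_ (by positivity) |>.2
  have h0 : 0 ≤ ∑ u ∈ Finset.range n, blockMass r b u ^ 2 :=
    Finset.sum_nonneg fun _ _ => sq_nonneg _
  calc _ ≤ _ := Finset.sum_mul_sq_le_sq_mul_sq U G (blockMass r b)
    _ ≤ (64 * K) * ∑ u ∈ Finset.range n, blockMass r b u ^ 2 := by
        gcongr
    _ = _ := by
        rw [mul_pow, mul_pow, Real.sq_sqrt h0, Real.sq_sqrt (Nat.cast_nonneg K)]
        ring

/-- The multiscale energy of `r`, over blocks of lengths `1, 16, …, 16 ^ J`. -/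
noncomputable def energy {n : ℕ} (J : ℕ) (r : Fin n → ℝ) : ℝ :=
  ∑ i ∈ Finset.range (J + 1), 2 ^ J / 2 ^ i *
    ∑ u ∈ Finset.range n, blockMass r (16 ^ i) u ^ 2

theorem sum_two_pow_le (J : ℕ) : ∑ i ∈ Finset.range (J + 1), (2 : ℝ) ^ i ≤ 2 * 2 ^ J := by
  rw [geom_sum_eq (by norm_num)]
  have : (2 : ℝ) ^ (J + 1) = 2 * 2 ^ J := by ring
  rw [this]
  norm_num

/-- A signed indicator: an interval partition witnesses a `±1` test function that changes its
value between the left end of a block and a later point of it in at most `k` blocks. -/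
theorem exists_signed_function {n k : ℕ} (r : Fin n → ℝ) (I : Fin k → Finset (Fin n))
    (hI : IsIntervalPartition I) :
    ∃ F : ℕ → ℝ, (∀ a, |F a| ≤ 1) ∧ ∑ j, |∑ x ∈ I j, r x| = ∑ x : Fin n, r x * F x ∧
      ∀ b : ℕ, ∃ S : Finset ℕ, S.card ≤ k ∧
        ∀ a t : ℕ, a < n → a / b = t → F a ≠ F (b * t) → t ∈ S := by
  classical
  choose idx hidx using hI.cover
  have huniq : ∀ x j, x ∈ I j → idx x = j := fun x j hx => by
    by_contra h
    exact Finset.disjoint_left.1 (hI.disjoint _ _ h) (hidx x) hx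
  set s : Fin k → ℝ := fun j => if 0 ≤ ∑ x ∈ I j, r x then 1 else -1 with hs
  have hs1 : ∀ j, |s j| ≤ 1 := fun j => by
    simp only [hs]
    split_ifs <;> simp
  set F : ℕ → ℝ := fun a => if h : a < n then s (idx ⟨a, h⟩) else 0 with hF
  have hFx : ∀ x : Fin n, F x = s (idx x) := fun x => by simp [hF]
  refine ⟨F, fun a => ?_, ?_, fun b => ?_⟩
  · simp only [hF]
    split_ifs
    · exact hs1 _
    · simp
  · simp only [hFx]
    have hIj : ∀ j, I j = Finset.univ.filter fun x => idx x = j := fun j => by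
      ext x
      simp only [Finset.mem_filter, Finset.mem_univ, true_and]
      exact ⟨huniq x j, fun h => h ▸ hidx x⟩
    rw [← Finset.sum_fiberwise Finset.univ idx]
    refine Finset.sum_congr rfl fun j _ => ?_
    have e1 : ∑ x ∈ Finset.univ.filter (fun x => idx x = j), r x * s (idx x) =
        (∑ x ∈ I j, r x) * s j := by
      rw [Finset.sum_mul, hIj]
      refine Finset.sum_congr rfl fun x hx => ?_
      rw [(Finset.mem_filter.1 hx).2]
    rw [e1]
    simp only [hs]
    split_ifs with h
    · rw [abs_of_nonneg h, mul_one]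
    · rw [abs_of_neg (not_le.1 h)]
      ring
  -- The listed blocks are those where some part has its minimum. An empty part gets the dummy
  -- minimum 0, which at worst lists block 0 needlessly.
  · set mn : Fin k → ℕ := fun j => if h : (I j).Nonempty then ((I j).min' h : ℕ) else 0 with hmn
    refine ⟨Finset.univ.image fun j => mn j / b,
      Finset.card_image_le.trans (by simp), fun a t ha hat hne => ?_⟩
    rw [Finset.mem_image]
    have hLa : b * t ≤ a := hat ▸ Nat.mul_div_le a b
    have hL : b * t < n := lt_of_le_of_lt hLa ha
    have hneq : idx ⟨a, ha⟩ ≠ idx ⟨b * t, hL⟩ := fun h => hne <| by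
      simp only [hF, dif_pos ha, dif_pos hL, h]
    refine ⟨idx ⟨a, ha⟩, Finset.mem_univ _, ?_⟩
    have hnon : (I (idx ⟨a, ha⟩)).Nonempty := ⟨_, hidx _⟩
    have hmin : mn (idx ⟨a, ha⟩) = (I (idx ⟨a, ha⟩)).min' hnon := by simp only [hmn, dif_pos hnon]
    have hle : (I (idx ⟨a, ha⟩)).min' hnon ≤ ⟨a, ha⟩ := Finset.min'_le _ _ (hidx _)
    -- If the part of `a` began before the block, convexity would put the left end `b * t` in the
    -- same part, and `F` would not change.
    have hgt : ⟨b * t, hL⟩ ≤ (I (idx ⟨a, ha⟩)).min' hnon := by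
      by_contra hlt
      have hmem := (hI.interval (idx ⟨a, ha⟩)).out
        (Finset.mem_coe.2 (Finset.min'_mem _ hnon)) (Finset.mem_coe.2 (hidx ⟨a, ha⟩))
        ⟨(not_le.1 hlt).le, Fin.mk_le_mk.2 hLa⟩
      exact hneq (huniq _ _ (Finset.mem_coe.1 hmem)).symm
    have hle' : ((I (idx ⟨a, ha⟩)).min' hnon : ℕ) ≤ a := hle
    have hgt' : b * t ≤ ((I (idx ⟨a, ha⟩)).min' hnon : ℕ) := hgt
    rw [hmin]
    rcases Nat.eq_zero_or_pos b with rfl | hb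
    · simpa using hat
    · refine le_antisymm (hat ▸ Nat.div_le_div_right hle') ?_
      rw [Nat.le_div_iff_mul_le hb, mul_comm]
      exact hgt'

/-- Chaining: `g i` samples `F` at the left end of the level-`i` block, so `g 0 = F`. The difference
`g i - g (i + 1)` lives on the 16 children of each of at most `k` parent blocks, and `hJ` leaves at
most `16 k` blocks at the top level. -/
theorem sum_abs_le_sum_levels {n k J : ℕ} (r : Fin n → ℝ) (I : Fin k → Finset (Fin n))
    (hI : IsIntervalPartition I) (hJ : n ≤ k * 16 ^ (J + 1)) :
    ∑ j, |∑ x ∈ I j, r x| ≤ ∑ i ∈ Finset.range (J + 1),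
      8 * √k * √(∑ u ∈ Finset.range n, blockMass r (16 ^ i) u ^ 2) := by
  classical
  obtain ⟨F, hF1, hFsum, hFS⟩ := exists_signed_function r I hI
  set g : ℕ → Fin n → ℝ := fun i x => F (16 ^ i * (x / 16 ^ i)) with hg
  have hparent : ∀ i (x : ℕ), x / 16 ^ (i + 1) = x / 16 ^ i / 16 := fun i x => by
    rw [pow_succ, Nat.div_div_eq_div_mul]
  have etel : ∀ x : Fin n, F x = ∑ i ∈ Finset.range J, (g i x - g (i + 1) x) + g J x := fun x => by
    rw [Finset.sum_range_sub' (fun i => g i x)]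
    simp [hg]
  have hlevel : ∀ i, ∑ x, r x * (g i x - g (i + 1) x) ≤
      8 * √k * √(∑ u ∈ Finset.range n, blockMass r (16 ^ i) u ^ 2) := fun i => by
    obtain ⟨S, hSc, hS⟩ := hFS (16 ^ (i + 1))
    refine sum_mul_block_le r (16 ^ i) k _
      (fun u => F (16 ^ i * u) - F (16 ^ (i + 1) * (u / 16)))
      (fun x => by simp only [hg, hparent]) (fun u => ?_)
      ((Finset.range n).filter fun u => u / 16 ∈ S) (Finset.filter_subset _ _)
      (fun x hx => ?_) ?_
    · refine (abs_sub _ _).trans ?_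
      linarith [hF1 (16 ^ i * u), hF1 (16 ^ (i + 1) * (u / 16))]
    · refine Finset.mem_filter.2 ⟨Finset.mem_range.2 (lt_of_le_of_lt (Nat.div_le_self _ _) x.2), ?_⟩
      rw [← hparent]
      refine hS (16 ^ i * (x / 16 ^ i)) _ (lt_of_le_of_lt (Nat.mul_div_le _ _) x.2) ?_
        (sub_ne_zero.1 hx)
      rw [hparent, hparent, Nat.mul_div_cancel_left _ (by positivity)]
    · refine (Finset.card_le_mul_card_image (f := fun u => u / 16) _ 16 fun t _ => ?_).trans
        (Nat.mul_le_mul_left 16 ((Finset.card_le_card fun t ht => ?_).trans hSc))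
      · refine (Finset.card_le_card (t := Finset.Ico (16 * t) (16 * t + 16)) fun u hu => ?_).trans
          (by simp)
        have := (Finset.mem_filter.1 hu).2
        rw [Finset.mem_Ico]
        omega
      · obtain ⟨u, hu, rfl⟩ := Finset.mem_image.1 ht
        exact (Finset.mem_filter.1 hu).2
  have htop : ∑ x, r x * g J x ≤
      8 * √k * √(∑ u ∈ Finset.range n, blockMass r (16 ^ J) u ^ 2) := by
    refine sum_mul_block_le r (16 ^ J) k _ (fun u => F (16 ^ J * u)) (fun x => rfl)
      (fun u => (hF1 _).trans one_le_two)
      ((Finset.range n).filter fun u => u < 16 * k) (Finset.filter_subset _ _)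
      (fun x _ => ?_) ?_
    · refine Finset.mem_filter.2
        ⟨Finset.mem_range.2 (lt_of_le_of_lt (Nat.div_le_self _ _) x.2), ?_⟩
      rw [Nat.div_lt_iff_lt_mul (by positivity)]
      calc (x : ℕ) < n := x.2
        _ ≤ _ := hJ
        _ = _ := by ring
    · refine (Finset.card_le_card (t := Finset.range (16 * k)) fun u hu => ?_).trans (by simp)
      exact Finset.mem_range.2 (Finset.mem_filter.1 hu).2
  rw [hFsum, Finset.sum_range_succ]
  simp only [etel, mul_add, Finset.sum_add_distrib, Finset.mul_sum (Finset.range J)]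
  rw [Finset.sum_comm]
  exact add_le_add (Finset.sum_le_sum fun i _ => hlevel i) htop

/-- Cauchy–Schwarz across levels with weights `2 ^ i / 2 ^ J`, whose sum is at most 2 for every `J`.
-/
theorem sq_sum_abs_le_energy {n k J : ℕ} (r : Fin n → ℝ) (I : Fin k → Finset (Fin n))
    (hI : IsIntervalPartition I) (hJ : n ≤ k * 16 ^ (J + 1)) :
    (∑ j, |∑ x ∈ I j, r x|) ^ 2 ≤ 128 * k * energy J r := by
  have h := sum_abs_le_sum_levels r I hI hJ
  have hR : ∀ i, 0 ≤ ∑ u ∈ Finset.range n, blockMass r (16 ^ i) u ^ 2 := fun i =>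
    Finset.sum_nonneg fun _ _ => sq_nonneg _
  have hcs : (∑ i ∈ Finset.range (J + 1),
        √(∑ u ∈ Finset.range n, blockMass r (16 ^ i) u ^ 2)) ^ 2 ≤
      (∑ i ∈ Finset.range (J + 1), (2 : ℝ) ^ i / 2 ^ J) * energy J r := by
    refine Finset.sum_sq_le_sum_mul_sum_of_sq_le_mul _ (fun i _ => by positivity)
      (fun i _ => mul_nonneg (by positivity) (hR i)) fun i _ => ?_
    rw [Real.sq_sqrt (hR i)]
    refine le_of_eq ?_
    field_simp
  have h2 : ∑ i ∈ Finset.range (J + 1), (2 : ℝ) ^ i / 2 ^ J ≤ 2 := by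
    rw [← Finset.sum_div, div_le_iff₀ (by positivity)]
    exact sum_two_pow_le J
  have hE : 0 ≤ energy J r := Finset.sum_nonneg fun i _ => mul_nonneg (by positivity) (hR i)
  rw [← Finset.mul_sum] at h
  calc _ ≤ _ := pow_le_pow_left₀ (Finset.sum_nonneg fun _ _ => abs_nonneg _) h 2
    _ = 64 * k * (∑ i ∈ Finset.range (J + 1),
        √(∑ u ∈ Finset.range n, blockMass r (16 ^ i) u ^ 2)) ^ 2 := by
        rw [mul_pow, mul_pow, Real.sq_sqrt (Nat.cast_nonneg k)]
        norm_num
    _ ≤ 64 * k * (2 * energy J r) := by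
        gcongr
        exact hcs.trans (by gcongr)
    _ = _ := by ring

theorem exists_partition_of_lt_akDist {n k : ℕ} {p q : Fin n → ℝ} {ε : ℝ} (hε : 0 < ε)
    (h : ε < akDist k p q) :
    ∃ I : Fin k → Finset (Fin n), IsIntervalPartition I ∧
      ε < ∑ j, |∑ x ∈ I j, (p - q) x| := by
  rcases isEmpty_or_nonempty {I : Fin k → Finset (Fin n) // IsIntervalPartition I} with he | he
  · rw [akDist, Real.iSup_of_isEmpty] at h
    linarith
  · obtain ⟨I, hI⟩ := exists_lt_of_lt_ciSup h
    refine ⟨I.1, I.2, ?_⟩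
    simpa only [mass, Pi.sub_apply, Finset.sum_sub_distrib] using hI

theorem akDist_le_two {n k : ℕ} {p q : Fin n → ℝ} (hp : p ∈ stdSimplex ℝ (Fin n))
    (hq : q ∈ stdSimplex ℝ (Fin n)) : akDist k p q ≤ 2 := by
  by_contra! h
  obtain ⟨I, hI, hlt⟩ := exists_partition_of_lt_akDist two_pos h
  obtain ⟨F, hF1, hFsum, -⟩ := exists_signed_function (p - q) I hI
  refine absurd hlt (not_lt.2 ?_)
  rw [hFsum]
  calc ∑ x : Fin n, (p - q) x * F x ≤ ∑ x, (p x + q x) := Finset.sum_le_sum fun x _ => by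
        have h1 := hp.1 x
        have h2 := hq.1 x
        have h3 := abs_le.1 (hF1 x)
        rw [Pi.sub_apply]
        nlinarith
    _ = 2 := by
        rw [Finset.sum_add_distrib, hp.2, hq.2]
        norm_num

/-! ### Block features, their kernel, and a single run of the test -/

/-- The feature vector of a point: normalized indicators of the blocks that contain it. -/
noncomputable def blockFeature {n : ℕ} (J : ℕ) (x : Fin n) (s : Fin (J + 1) × Fin n) : ℝ :=
  √(2 ^ J / 2 ^ (s.1 : ℕ)) * if (x : ℕ) / 16 ^ (s.1 : ℕ) = s.2 then 1 else 0

/-- The kernel of `blockFeature`. -/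
noncomputable def blockKernel {n : ℕ} (J : ℕ) (x y : Fin n) : ℝ :=
  ∑ i ∈ Finset.range (J + 1), 2 ^ J / 2 ^ i *
    if (x : ℕ) / 16 ^ i = (y : ℕ) / 16 ^ i then 1 else 0

theorem sum_blockFeature_mul {n : ℕ} (J : ℕ) (x y : Fin n) :
    ∑ s, blockFeature J x s * blockFeature J y s = blockKernel J x y := by
  rw [Fintype.sum_prod_type, blockKernel, Finset.sum_range]
  refine Finset.sum_congr rfl fun i _ => ?_
  have hx : (x : ℕ) / 16 ^ (i : ℕ) < n := lt_of_le_of_lt (Nat.div_le_self _ _) x.2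
  rw [Finset.sum_eq_single ⟨(x : ℕ) / 16 ^ (i : ℕ), hx⟩]
  · simp only [blockFeature, if_true, mul_one]
    rw [← mul_assoc, Real.mul_self_sqrt (by positivity)]
    simp only [eq_comm]
  · intro u _ hu
    have : (x : ℕ) / 16 ^ (i : ℕ) ≠ u := fun h => hu (Fin.ext h.symm)
    simp [blockFeature, this]
  · simp

theorem energy_eq {n : ℕ} (J : ℕ) (r : Fin n → ℝ) :
    energy J r = ∑ s, (∑ x, r x * blockFeature J x s) ^ 2 := by
  rw [Fintype.sum_prod_type, energy, Finset.sum_range]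
  refine Finset.sum_congr rfl fun i _ => ?_
  rw [Finset.sum_range, Finset.mul_sum]
  refine Finset.sum_congr rfl fun u _ => ?_
  have : ∑ x, r x * blockFeature J x (i, u) =
      √(2 ^ J / 2 ^ (i : ℕ)) * blockMass r (16 ^ (i : ℕ)) u := by
    rw [blockMass, Finset.mul_sum]
    exact Finset.sum_congr rfl fun x _ => by simp only [blockFeature]; ring
  rw [this, mul_pow, Real.sq_sqrt (by positivity)]

theorem card_block_le {n b : ℕ} (hb : 0 < b) (x : Fin n) :
    ∑ y : Fin n, (if (x : ℕ) / b = (y : ℕ) / b then (1 : ℝ) else 0) ≤ b := by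
  rw [Finset.sum_boole]
  norm_cast
  rw [← Finset.card_map Fin.valEmbedding]
  refine (Finset.card_le_card
    (t := Finset.Ico (b * ((x : ℕ) / b)) (b * ((x : ℕ) / b) + b)) fun u hu => ?_).trans (by simp)
  obtain ⟨y, hy, rfl⟩ := Finset.mem_map.1 hu
  have h := (Finset.mem_filter.1 hy).2
  rw [Finset.mem_Ico, h]
  exact ⟨Nat.mul_div_le _ _, Nat.lt_mul_div_succ _ hb⟩

/-- Use `p x * q y ≤ (p x ^ 2 + q y ^ 2) / 2` and the fact that a point shares its block with at
most `b` points. -/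
theorem collision_le {n b : ℕ} (hb : 0 < b) {p q : Fin n → ℝ} {A : ℝ}
    (hp : ∑ x, p x ^ 2 ≤ A) (hq : ∑ x, q x ^ 2 ≤ A) :
    ∑ x, ∑ y, p x * q y * (if (x : ℕ) / b = (y : ℕ) / b then 1 else 0) ≤ b * A := by
  have h1 : ∑ x : Fin n, ∑ y : Fin n,
      p x ^ 2 * (if (x : ℕ) / b = (y : ℕ) / b then (1 : ℝ) else 0) ≤ b * A := by
    simp only [← Finset.mul_sum]
    calc _ ≤ ∑ x, p x ^ 2 * b := Finset.sum_le_sum fun x _ =>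
          mul_le_mul_of_nonneg_left (card_block_le hb x) (sq_nonneg _)
      _ ≤ _ := by
          rw [← Finset.sum_mul, mul_comm]
          gcongr
  have h2 : ∑ x : Fin n, ∑ y : Fin n,
      q y ^ 2 * (if (x : ℕ) / b = (y : ℕ) / b then (1 : ℝ) else 0) ≤ b * A := by
    rw [Finset.sum_comm]
    simp only [← Finset.mul_sum]
    calc _ ≤ ∑ x, q x ^ 2 * b := Finset.sum_le_sum fun x _ => by
          refine mul_le_mul_of_nonneg_left ?_ (sq_nonneg _)
          simpa only [eq_comm] using card_block_le hb x
      _ ≤ _ := by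
          rw [← Finset.sum_mul, mul_comm]
          gcongr
  calc _ ≤ ∑ x : Fin n, ∑ y : Fin n,
        (1 / 2 * (p x ^ 2 * (if (x : ℕ) / b = (y : ℕ) / b then (1 : ℝ) else 0)) +
          1 / 2 * (q y ^ 2 * (if (x : ℕ) / b = (y : ℕ) / b then (1 : ℝ) else 0))) :=
        Finset.sum_le_sum fun x _ => Finset.sum_le_sum fun y _ => by
          split_ifs <;> nlinarith [sq_nonneg (p x - q y)]
    _ ≤ _ := by
        simp only [Finset.sum_add_distrib, ← Finset.mul_sum] at h1 h2 ⊢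
        linarith

/-- After Cauchy–Schwarz over levels, level `i` contributes in proportion to `8 ^ (-i) * 16 ^ i = 2
^ i`. The coarsest level dominates, and there `16 ^ J / n ≤ 1 / k`. -/
theorem sum_blockKernel_sq_le {n k J : ℕ} (hk : 0 < k) (hn : 0 < n) (hJ : k * 16 ^ J ≤ n) {B : ℝ}
    {p q : Fin n → ℝ} (hp0 : ∀ x, 0 ≤ p x) (hq0 : ∀ x, 0 ≤ q x)
    (hp : ∑ x, p x ^ 2 ≤ B ^ 2 / n) (hq : ∑ x, q x ^ 2 ≤ B ^ 2 / n) :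
    ∑ x, ∑ y, p x * q y * blockKernel J x y ^ 2 ≤ 4 * B ^ 2 / k := by
  have hK : ∀ x y : Fin n, blockKernel J x y ^ 2 ≤ (2 * 4 ^ J) *
      ∑ i ∈ Finset.range (J + 1), 2 ^ J / 8 ^ i *
        if (x : ℕ) / 16 ^ i = (y : ℕ) / 16 ^ i then 1 else 0 := fun x y => by
    -- The squared weight `4 ^ J / 4 ^ i` is split as `(2 ^ J * 2 ^ i) * (2 ^ J / 8 ^ i)`, so that
    -- the first factor sums geometrically.
    have h := Finset.sum_sq_le_sum_mul_sum_of_sq_le_mul (Finset.range (J + 1))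
      (r := fun i => (2 : ℝ) ^ J / 2 ^ i *
        if (x : ℕ) / 16 ^ i = (y : ℕ) / 16 ^ i then 1 else 0)
      (f := fun i => 2 ^ J * 2 ^ i)
      (g := fun i => 2 ^ J / 8 ^ i *
        if (x : ℕ) / 16 ^ i = (y : ℕ) / 16 ^ i then 1 else 0)
      (fun i _ => by positivity) (fun i _ => by split_ifs <;> positivity) (fun i _ => by
        split_ifs
        · rw [show (8 : ℝ) = 2 * 2 * 2 by norm_num, mul_pow, mul_pow]
          refine le_of_eq ?_
          field_simp
          exact pow_right_comm 2 2 i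
        · simp)
    refine h.trans (mul_le_mul_of_nonneg_right ?_
      (Finset.sum_nonneg fun i _ => by split_ifs <;> positivity))
    rw [← Finset.mul_sum]
    calc _ ≤ (2 : ℝ) ^ J * (2 * 2 ^ J) := by gcongr; exact sum_two_pow_le J
      _ = _ := by rw [show (4 : ℝ) = 2 * 2 by norm_num, mul_pow]; ring
  calc _ ≤ ∑ x : Fin n, ∑ y : Fin n, p x * q y * ((2 * 4 ^ J) *
        ∑ i ∈ Finset.range (J + 1), 2 ^ J / 8 ^ i *
          if (x : ℕ) / 16 ^ i = (y : ℕ) / 16 ^ i then 1 else 0) :=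
        Finset.sum_le_sum fun x _ => Finset.sum_le_sum fun y _ =>
          mul_le_mul_of_nonneg_left (hK x y) (mul_nonneg (hp0 x) (hq0 y))
    _ = (2 * 4 ^ J) * ∑ i ∈ Finset.range (J + 1), 2 ^ J / 8 ^ i *
        ∑ x : Fin n, ∑ y : Fin n,
          p x * q y * (if (x : ℕ) / 16 ^ i = (y : ℕ) / 16 ^ i then 1 else 0) := by
        simp only [Finset.mul_sum]
        simp_rw [Finset.sum_comm (s := Finset.range (J + 1))]
        exact Finset.sum_congr rfl fun x _ => Finset.sum_congr rfl fun y _ =>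
          Finset.sum_congr rfl fun i _ => by ring
    _ ≤ (2 * 4 ^ J) * ∑ i ∈ Finset.range (J + 1), 2 ^ J / 8 ^ i *
        (((16 ^ i : ℕ) : ℝ) * (B ^ 2 / n)) := by
        gcongr with i _
        exact collision_le (by positivity) hp hq
    _ = (2 * 4 ^ J) * (2 ^ J * (B ^ 2 / n) * ∑ i ∈ Finset.range (J + 1), 2 ^ i) := by
        congr 1
        rw [Finset.mul_sum]
        refine Finset.sum_congr rfl fun i _ => ?_
        push_cast
        rw [show (16 : ℝ) = 8 * 2 by norm_num, mul_pow]
        field_simp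
    _ ≤ (2 * 4 ^ J) * (2 ^ J * (B ^ 2 / n) * (2 * 2 ^ J)) := by
        gcongr
        exact sum_two_pow_le J
    _ = 4 * B ^ 2 * (16 ^ J / n) := by
        rw [show (16 : ℝ) = 4 * 2 * 2 by norm_num, mul_pow, mul_pow]
        ring
    _ ≤ 4 * B ^ 2 * (1 / k) := by
        refine mul_le_mul_of_nonneg_left ?_ (by positivity)
        rw [div_le_div_iff₀ (by positivity) (by positivity), one_mul, mul_comm]
        exact_mod_cast hJ
    _ = _ := by ring

/-- Chebyshev with the threshold halfway to the smallest mean `m² τ` to be detected. In the far case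
the relative variance bound is `4 (1 / 64² + 2 / 64) < 1 / 6`, which is what the constant 64
secures. -/
theorem pairStat_test {Ω S : Type*} [Fintype Ω] [Fintype S] {m : ℕ} {w : Ω → ℝ}
    (hw0 : ∀ a, 0 ≤ w a) (hw : ∑ a, w a = 1) (v : Ω → S → ℝ) {F τ : ℝ} (hF : 0 < F) (hτ : 0 < τ)
    (hH : ∑ a, ∑ b, w a * w b * (∑ s, v a s * v b s) ^ 2 ≤ F ^ 2) (hm : 64 * F ≤ m * τ) :
    (∑ s, meanVec w v s ^ 2 = 0 →
      ∑ z : (Fin m → Ω) × (Fin m → Ω), prodWeight w z.1 * prodWeight w z.2 *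
        (if ¬ pairStat v z.1 z.2 < m ^ 2 * τ / 2 then 1 else 0) ≤ 1 / 6) ∧
    (τ ≤ ∑ s, meanVec w v s ^ 2 →
      ∑ z : (Fin m → Ω) × (Fin m → Ω), prodWeight w z.1 * prodWeight w z.2 *
        (if pairStat v z.1 z.2 < m ^ 2 * τ / 2 then 1 else 0) ≤ 1 / 6) := by
  have hW : ∀ z : (Fin m → Ω) × (Fin m → Ω), 0 ≤ prodWeight w z.1 * prodWeight w z.2 := fun z =>
    mul_nonneg (prodWeight_nonneg hw0 _) (prodWeight_nonneg hw0 _)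
  have hV := sum_pairStat_sub_sq_le (m := m) hw v hF.le hH
  rw [← Fintype.sum_prod_type'
    (f := fun z z' : Fin m → Ω => prodWeight w z * prodWeight w z' *
      (pairStat v z z' - m ^ 2 * ∑ s, meanVec w v s ^ 2) ^ 2)] at hV
  have hm0 : 0 < (m : ℝ) := by
    by_contra h
    have := mul_nonpos_of_nonpos_of_nonneg (not_lt.1 h) hτ.le
    linarith
  constructor
  · intro hM
    rw [hM] at hV
    refine (sum_ite_le_of_sum_sq_le (f := fun z => pairStat v z.1 z.2)
      (c := (m : ℝ) ^ 2 * 0) (L := (m ^ 2 * τ / 2) ^ 2) hW (by positivity) _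
      fun z hz => ?_).trans ?_
    · rw [mul_zero, sub_zero]
      exact pow_le_pow_left₀ (by positivity) (not_lt.1 hz) 2
    · rw [div_le_iff₀ (by positivity)]
      refine hV.trans ?_
      have h1 : (64 * F) ^ 2 ≤ (m * τ) ^ 2 := pow_le_pow_left₀ (by positivity) hm 2
      calc _ = (m : ℝ) ^ 2 / 64 ^ 2 * (64 * F) ^ 2 := by ring
        _ ≤ (m : ℝ) ^ 2 / 64 ^ 2 * (m * τ) ^ 2 := by gcongr
        _ ≤ (m : ℝ) ^ 2 / 24 * (m * τ) ^ 2 := by gcongr; norm_num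
        _ = _ := by ring
  · intro hM
    set M := ∑ s, meanVec w v s ^ 2
    have hM0 : 0 < M := hτ.trans_le hM
    refine (sum_ite_le_of_sum_sq_le (f := fun z => pairStat v z.1 z.2)
      (c := (m : ℝ) ^ 2 * M) (L := (m ^ 2 * M / 2) ^ 2) hW (by positivity) _
      fun z hz => ?_).trans ?_
    · rw [← neg_sq (pairStat v z.1 z.2 - _), neg_sub]
      refine pow_le_pow_left₀ (by positivity) ?_ 2
      have : (m : ℝ) ^ 2 * τ / 2 ≤ m ^ 2 * M / 2 := by gcongr
      linarith
    · rw [div_le_iff₀ (by positivity)]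
      refine hV.trans ?_
      have h1 : 64 * F ≤ m * M := hm.trans (by gcongr)
      have h2 : F ^ 2 + 2 * F * (m * M) ≤ 1 / 24 * (m * M) ^ 2 := by nlinarith
      calc _ = (m : ℝ) ^ 2 * (F ^ 2 + 2 * F * (m * M)) := by ring
        _ ≤ (m : ℝ) ^ 2 * (1 / 24 * (m * M) ^ 2) := by gcongr
        _ = _ := by ring

/-! ### Pairs of samples from the two distributions -/

/-- The joint distribution of a sample from `p` and an independent sample from `q`. -/
noncomputable def jointWeight {n : ℕ} (p q : Fin n → ℝ) (a : Fin n × Fin n) : ℝ :=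
  p a.1 * q a.2

theorem sum_jointWeight_mul {n : ℕ} (p q : Fin n → ℝ) (f : Fin n → Fin n → ℝ) :
    ∑ a, jointWeight p q a * f a.1 a.2 = ∑ x, ∑ y, p x * q y * f x y := by
  rw [Fintype.sum_prod_type]
  rfl

theorem sum_jointWeight {n : ℕ} {p q : Fin n → ℝ} (hp : ∑ x, p x = 1) (hq : ∑ x, q x = 1) :
    ∑ a, jointWeight p q a = 1 := by
  have h := sum_jointWeight_mul p q fun _ _ => 1
  simp only [mul_one] at h
  rw [h, ← Finset.sum_mul_sum, hp, hq, one_mul]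

theorem sum_jointWeight_mul_fst {n : ℕ} (p : Fin n → ℝ) {q : Fin n → ℝ} (hq : ∑ x, q x = 1)
    (f : Fin n → ℝ) : ∑ a, jointWeight p q a * f a.1 = ∑ x, p x * f x := by
  rw [sum_jointWeight_mul p q fun x _ => f x]
  refine Finset.sum_congr rfl fun x _ => ?_
  rw [← Finset.sum_mul, ← Finset.mul_sum, hq, mul_one]

theorem sum_jointWeight_mul_snd {n : ℕ} {p : Fin n → ℝ} (q : Fin n → ℝ) (hp : ∑ x, p x = 1)
    (f : Fin n → ℝ) : ∑ a, jointWeight p q a * f a.2 = ∑ x, q x * f x := by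
  rw [sum_jointWeight_mul p q fun _ y => f y, Finset.sum_comm]
  refine Finset.sum_congr rfl fun x _ => ?_
  rw [← Finset.sum_mul, ← Finset.sum_mul, hp, one_mul]

/-- The difference of the feature vectors of the two components of a sample pair. -/
noncomputable def diffFeature {n : ℕ} (J : ℕ) (a : Fin n × Fin n) (s : Fin (J + 1) × Fin n) : ℝ :=
  blockFeature J a.1 s - blockFeature J a.2 s

theorem sum_meanVec_sq {n : ℕ} (J : ℕ) {p q : Fin n → ℝ} (hp : ∑ x, p x = 1)
    (hq : ∑ x, q x = 1) :
    ∑ s, meanVec (jointWeight p q) (diffFeature J) s ^ 2 = energy J (p - q) := by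
  rw [energy_eq]
  refine Finset.sum_congr rfl fun s _ => ?_
  simp only [meanVec, diffFeature, mul_sub, Finset.sum_sub_distrib, Pi.sub_apply, sub_mul]
  rw [sum_jointWeight_mul_fst p hq fun x => blockFeature J x s,
    sum_jointWeight_mul_snd q hp fun x => blockFeature J x s]

theorem sum_diffFeature_sq_le {n J : ℕ} {p q : Fin n → ℝ} (hp0 : ∀ x, 0 ≤ p x)
    (hq0 : ∀ x, 0 ≤ q x) (hp : ∑ x, p x = 1) (hq : ∑ x, q x = 1) {G : ℝ}
    (hpp : ∑ x, ∑ y, p x * p y * blockKernel J x y ^ 2 ≤ G)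
    (hpq : ∑ x, ∑ y, p x * q y * blockKernel J x y ^ 2 ≤ G)
    (hqp : ∑ x, ∑ y, q x * p y * blockKernel J x y ^ 2 ≤ G)
    (hqq : ∑ x, ∑ y, q x * q y * blockKernel J x y ^ 2 ≤ G) :
    ∑ a, ∑ b, jointWeight p q a * jointWeight p q b *
      (∑ s, diffFeature J a s * diffFeature J b s) ^ 2 ≤ 16 * G := by
  have hK : ∀ a b : Fin n × Fin n, (∑ s, diffFeature J a s * diffFeature J b s) ^ 2 ≤
      4 * (blockKernel J a.1 b.1 ^ 2 + blockKernel J a.1 b.2 ^ 2 + blockKernel J a.2 b.1 ^ 2 +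
        blockKernel J a.2 b.2 ^ 2) := fun a b => by
    have e : ∑ s, diffFeature J a s * diffFeature J b s = blockKernel J a.1 b.1 -
        blockKernel J a.1 b.2 - blockKernel J a.2 b.1 + blockKernel J a.2 b.2 := by
      simp only [← sum_blockFeature_mul, ← Finset.sum_sub_distrib, ← Finset.sum_add_distrib]
      exact Finset.sum_congr rfl fun s _ => by simp only [diffFeature]; ring
    rw [e]
    generalize blockKernel J a.1 b.1 = k1
    generalize blockKernel J a.1 b.2 = k2
    generalize blockKernel J a.2 b.1 = k3
    generalize blockKernel J a.2 b.2 = k4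
    -- The six squares are the pairwise differences of the signed terms `k1, -k2, -k3, k4`; their
    -- sum is exactly the gap in Cauchy–Schwarz.
    nlinarith [sq_nonneg (k1 + k2), sq_nonneg (k1 + k3), sq_nonneg (k1 - k4),
      sq_nonneg (k2 - k3), sq_nonneg (k2 + k4), sq_nonneg (k3 + k4)]
  have hw0 : ∀ a, 0 ≤ jointWeight p q a := fun a => mul_nonneg (hp0 _) (hq0 _)
  have e1 : ∀ f : Fin n → Fin n → ℝ, ∑ a, ∑ b, jointWeight p q a * jointWeight p q b *
      f a.1 b.1 = ∑ x, ∑ y, p x * p y * f x y := fun f => by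
    simp only [mul_assoc, ← Finset.mul_sum]
    have h : ∀ x, ∑ b, jointWeight p q b * f x b.1 = ∑ y, p y * f x y := fun x =>
      sum_jointWeight_mul_fst p hq (f x)
    simp only [h]
    rw [sum_jointWeight_mul_fst p hq fun x => ∑ y, p y * f x y]
  have e2 : ∀ f : Fin n → Fin n → ℝ, ∑ a, ∑ b, jointWeight p q a * jointWeight p q b *
      f a.1 b.2 = ∑ x, ∑ y, p x * q y * f x y := fun f => by
    simp only [mul_assoc, ← Finset.mul_sum]
    have h : ∀ x, ∑ b, jointWeight p q b * f x b.2 = ∑ y, q y * f x y := fun x =>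
      sum_jointWeight_mul_snd q hp (f x)
    simp only [h]
    rw [sum_jointWeight_mul_fst p hq fun x => ∑ y, q y * f x y]
  have e3 : ∀ f : Fin n → Fin n → ℝ, ∑ a, ∑ b, jointWeight p q a * jointWeight p q b *
      f a.2 b.1 = ∑ x, ∑ y, q x * p y * f x y := fun f => by
    simp only [mul_assoc, ← Finset.mul_sum]
    have h : ∀ x, ∑ b, jointWeight p q b * f x b.1 = ∑ y, p y * f x y := fun x =>
      sum_jointWeight_mul_fst p hq (f x)
    simp only [h]
    rw [sum_jointWeight_mul_snd q hp fun x => ∑ y, p y * f x y]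
  have e4 : ∀ f : Fin n → Fin n → ℝ, ∑ a, ∑ b, jointWeight p q a * jointWeight p q b *
      f a.2 b.2 = ∑ x, ∑ y, q x * q y * f x y := fun f => by
    simp only [mul_assoc, ← Finset.mul_sum]
    have h : ∀ x, ∑ b, jointWeight p q b * f x b.2 = ∑ y, q y * f x y := fun x =>
      sum_jointWeight_mul_snd q hp (f x)
    simp only [h]
    rw [sum_jointWeight_mul_snd q hp fun x => ∑ y, q y * f x y]
  rw [← e1 fun x y => blockKernel J x y ^ 2] at hpp
  rw [← e2 fun x y => blockKernel J x y ^ 2] at hpq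
  rw [← e3 fun x y => blockKernel J x y ^ 2] at hqp
  rw [← e4 fun x y => blockKernel J x y ^ 2] at hqq
  calc _ ≤ ∑ a, ∑ b, jointWeight p q a * jointWeight p q b *
        (4 * (blockKernel J a.1 b.1 ^ 2 + blockKernel J a.1 b.2 ^ 2 + blockKernel J a.2 b.1 ^ 2 +
          blockKernel J a.2 b.2 ^ 2)) :=
        Finset.sum_le_sum fun a _ => Finset.sum_le_sum fun b _ =>
          mul_le_mul_of_nonneg_left (hK a b) (mul_nonneg (hw0 a) (hw0 b))
    _ = 4 * ((∑ a, ∑ b, jointWeight p q a * jointWeight p q b * blockKernel J a.1 b.1 ^ 2) +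
        (∑ a, ∑ b, jointWeight p q a * jointWeight p q b * blockKernel J a.1 b.2 ^ 2) +
        (∑ a, ∑ b, jointWeight p q a * jointWeight p q b * blockKernel J a.2 b.1 ^ 2) +
        ∑ a, ∑ b, jointWeight p q a * jointWeight p q b * blockKernel J a.2 b.2 ^ 2) := by
        simp only [← Finset.sum_add_distrib, Finset.mul_sum]
        exact Finset.sum_congr rfl fun a _ => Finset.sum_congr rfl fun b _ => by ring
    _ ≤ _ := by linarith

/-! ### Amplification by independent runs -/

/-- Cutting a long sample into `N` blocks, each consisting of two samples of size `m`. -/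
noncomputable def blockEquiv (Ω : Type*) (N m : ℕ) :
    (Fin (N * (m + m)) → Ω) ≃ (Fin N → (Fin m → Ω) × (Fin m → Ω)) :=
  (Equiv.arrowCongr (((Equiv.refl (Fin N)).prodCongr finSumFinEquiv).trans finProdFinEquiv).symm
    (Equiv.refl Ω)).trans
    ((Equiv.curry _ _ _).trans
      (Equiv.piCongrRight fun _ => Equiv.sumArrowEquivProdArrow _ _ _))

theorem prodWeight_blockEquiv {Ω : Type*} {N m : ℕ} (w : Ω → ℝ) (z : Fin (N * (m + m)) → Ω) :
    prodWeight (fun b : (Fin m → Ω) × (Fin m → Ω) => prodWeight w b.1 * prodWeight w b.2)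
      (blockEquiv Ω N m z) = prodWeight w z := by
  simp only [prodWeight]
  rw [← (((Equiv.refl (Fin N)).prodCongr finSumFinEquiv).trans finProdFinEquiv).prod_comp,
    Fintype.prod_prod_type]
  refine Finset.prod_congr rfl fun i _ => ?_
  rw [Fintype.prod_sum_type]
  rfl

theorem sum_blockEquiv {Ω : Type*} [Fintype Ω] {N m : ℕ} (w : Ω → ℝ)
    (g : (Fin N → (Fin m → Ω) × (Fin m → Ω)) → ℝ) :
    ∑ z, prodWeight w z * g (blockEquiv Ω N m z) =
      ∑ y, prodWeight (fun b : (Fin m → Ω) × (Fin m → Ω) =>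
        prodWeight w b.1 * prodWeight w b.2) y * g y := by
  rw [← (blockEquiv Ω N m).sum_comp]
  simp only [prodWeight_blockEquiv]

/-- Zipping the two samples turns them into independent draws of pairs, so the one-distribution
moment bounds apply. -/
theorem sum_sampleProb_mul {n m : ℕ} (p q : Fin n → ℝ) (g : (Fin m → Fin n × Fin n) → ℝ) :
    ∑ x : Fin m → Fin n, ∑ y : Fin m → Fin n,
        sampleProb p x * sampleProb q y * g (fun i => (x i, y i)) =
      ∑ z, prodWeight (jointWeight p q) z * g z := by
  rw [← Fintype.sum_prod_type' (f := fun x y : Fin m → Fin n =>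
      sampleProb p x * sampleProb q y * g (fun i => (x i, y i))),
    ← (Equiv.arrowProdEquivProdArrow (Fin m) (fun _ => Fin n) (fun _ => Fin n)).sum_comp]
  refine Finset.sum_congr rfl fun z _ => ?_
  simp only [prodWeight, jointWeight, Finset.prod_mul_distrib]
  rfl

theorem probYes_add_probNo {n m : ℕ} (T : Tester n m) {p q : Fin n → ℝ} (hp : ∑ x, p x = 1)
    (hq : ∑ x, q x = 1) : probYes T p q + probNo T p q = 1 := by
  have h := sum_sampleProb_mul (m := m) p q fun _ => 1
  simp only [mul_one] at h
  rw [sum_prodWeight (sum_jointWeight hp hq)] at h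
  refine Eq.trans ?_ h
  rw [probYes, probNo]
  simp only [← Finset.sum_add_distrib]
  exact Finset.sum_congr rfl fun x _ => Finset.sum_congr rfl fun y _ => by ring

theorem probYes_const {n m : ℕ} (c : unitInterval) {p q : Fin n → ℝ} (hp : ∑ x, p x = 1)
    (hq : ∑ x, q x = 1) : probYes (fun _ _ => c : Tester n m) p q = c := by
  rw [probYes, sum_sampleProb_mul p q fun _ => (c : ℝ), ← Finset.sum_mul,
    sum_prodWeight (sum_jointWeight hp hq), one_mul]

open Classical in
/-- The tester that takes a majority vote over `N` independent runs of the test `yes`. -/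
noncomputable def majorityTester {n m : ℕ} (N : ℕ)
    (yes : (Fin m → Fin n × Fin n) × (Fin m → Fin n × Fin n) → Prop) : Tester n (N * (m + m)) :=
  fun x y => if N ≤ 2 * (Finset.univ.filter fun i =>
    yes (blockEquiv _ N m (fun j => (x j, y j)) i)).card then 1 else 0

open Classical in
theorem majorityTester_error {n m : ℕ} (N : ℕ)
    (yes : (Fin m → Fin n × Fin n) × (Fin m → Fin n × Fin n) → Prop) {p q : Fin n → ℝ}
    (hp0 : ∀ x, 0 ≤ p x) (hq0 : ∀ x, 0 ≤ q x) (hp : ∑ x, p x = 1) (hq : ∑ x, q x = 1) :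
    (∑ b, prodWeight (jointWeight p q) b.1 * prodWeight (jointWeight p q) b.2 *
        (if ¬ yes b then 1 else 0) ≤ 1 / 6 →
      probNo (majorityTester N yes) p q ≤ (3 / 4) ^ N) ∧
    (∑ b, prodWeight (jointWeight p q) b.1 * prodWeight (jointWeight p q) b.2 *
        (if yes b then 1 else 0) ≤ 1 / 6 →
      probYes (majorityTester N yes) p q ≤ (3 / 4) ^ N) := by
  set w := jointWeight p q
  have hw0 : ∀ a, 0 ≤ w a := fun a => mul_nonneg (hp0 _) (hq0 _)
  have hw1 : ∑ a, w a = 1 := sum_jointWeight hp hq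
  have hW0 : ∀ b : (Fin m → Fin n × Fin n) × (Fin m → Fin n × Fin n),
      0 ≤ prodWeight w b.1 * prodWeight w b.2 := fun b =>
    mul_nonneg (prodWeight_nonneg hw0 _) (prodWeight_nonneg hw0 _)
  have hW1 : ∑ b : (Fin m → Fin n × Fin n) × (Fin m → Fin n × Fin n),
      prodWeight w b.1 * prodWeight w b.2 = 1 := by
    rw [Fintype.sum_prod_type, ← Finset.sum_mul_sum, sum_prodWeight hw1, one_mul]
  constructor
  · intro h
    refine le_trans ?_ (sum_majority_le hW0 hW1 (fun b => ¬ yes b) h N)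
    rw [probNo, ← sum_blockEquiv w, ← sum_sampleProb_mul]
    refine Finset.sum_le_sum fun x _ => Finset.sum_le_sum fun y _ =>
      mul_le_mul_of_nonneg_left ?_ (mul_nonneg (Finset.prod_nonneg fun _ _ => hp0 _)
        (Finset.prod_nonneg fun _ _ => hq0 _))
    -- A tie is answered YES, but `sum_majority_le` already counts a tie as a failure, so it covers
    -- both kinds of error.
    have hc := Finset.card_filter_add_card_filter_not (s := (Finset.univ : Finset (Fin N)))
      fun i => yes (blockEquiv _ N m (fun j => (x j, y j)) i)
    rw [Finset.card_univ, Fintype.card_fin] at hc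
    simp only [majorityTester]
    split_ifs with h1 h2 h2
    · simp
    · simp
    · simp
    · omega
  · intro h
    refine le_trans (le_of_eq ?_) (sum_majority_le hW0 hW1 yes h N)
    rw [probYes, ← sum_blockEquiv w, ← sum_sampleProb_mul]
    refine Finset.sum_congr rfl fun x _ => Finset.sum_congr rfl fun y _ => ?_
    congr 1
    simp only [majorityTester]
    split_ifs <;> simp

/-! ### Choice of parameters and conclusion -/

theorem sum_sq_le_of_l2Norm_le {n : ℕ} {p : Fin n → ℝ} {b : ℝ}
    (h : l2Norm p ≤ b / √(n : ℝ)) : ∑ x, p x ^ 2 ≤ b ^ 2 / n := by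
  have h1 := (Real.sqrt_le_iff.1 h).2
  rwa [div_pow, Real.sq_sqrt (Nat.cast_nonneg n)] at h1

/-- A majority vote over `N` runs of the block statistic on `m` samples is a good tester. -/
theorem exists_majority_tester {n k m : ℕ} (N : ℕ) (hk : 0 < k) (hkn : k ≤ n) {b ε : ℝ}
    (hb : 0 < b) (hε : 0 < ε) (hm : 65536 * b * √k / ε ^ 2 ≤ m) :
    ∃ T : Tester n (N * (m + m)), ∀ p ∈ stdSimplex ℝ (Fin n), ∀ q ∈ stdSimplex ℝ (Fin n),
      ∑ x, p x ^ 2 ≤ b ^ 2 / n → ∑ x, q x ^ 2 ≤ b ^ 2 / n →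
        (p = q → probNo T p q ≤ (3 / 4) ^ N) ∧
        (ε < akDist k p q → probYes T p q ≤ (3 / 4) ^ N) := by
  have hn : 0 < n := hk.trans_le hkn
  have hk' : (0 : ℝ) < k := by exact_mod_cast hk
  -- The largest scale with `k * 16 ^ J ≤ n`: the variance bound needs this inequality, the chaining
  -- bound needs its failure at `J + 1`.
  set J := Nat.log 16 (n / k)
  have hJ1 : k * 16 ^ J ≤ n := by
    have h := Nat.pow_log_le_self 16 (Nat.div_pos hkn hk).ne'
    rw [mul_comm]
    exact (Nat.le_div_iff_mul_le hk).1 h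
  have hJ2 : n ≤ k * 16 ^ (J + 1) := by
    have h := Nat.lt_pow_succ_log_self (b := 16) (by norm_num) (n / k)
    rw [mul_comm]
    exact ((Nat.div_lt_iff_lt_mul hk).1 h).le
  -- `τ` is the energy forced by distance `ε`, and `F ^ 2` is 16 times the kernel bound `4 b ^ 2 /
  -- k`. The requirement `64 F ≤ m τ` then reads `m ≥ 64 * 8 * 128 * b √k / ε ^ 2`, whence 65536.
  set τ : ℝ := ε ^ 2 / (128 * k) with hτ
  set F : ℝ := 8 * b / √k with hF
  have hF0 : 0 < F := by positivity
  have hτ0 : 0 < τ := by positivity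
  have hFsq : F ^ 2 = 16 * (4 * b ^ 2 / k) := by
    rw [hF, div_pow, Real.sq_sqrt hk'.le]
    ring
  have hmτ : 64 * F ≤ m * τ := by
    calc 64 * F = 65536 * b * √k / ε ^ 2 * τ := by
          rw [hF, hτ]
          have : (k : ℝ) = √k * √k := (Real.mul_self_sqrt hk'.le).symm
          have hs : 0 < √(k : ℝ) := Real.sqrt_pos.2 hk'
          rw [div_mul_div_comm, mul_div_assoc', div_eq_div_iff hs.ne' (by positivity)]
          nth_rw 1 [this]
          ring
      _ ≤ m * τ := by gcongr
  refine ⟨majorityTester N fun z => pairStat (diffFeature J) z.1 z.2 < m ^ 2 * τ / 2,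
    fun p hp q hq hp2 hq2 => ?_⟩
  have hH := sum_diffFeature_sq_le (J := J) hp.1 hq.1 hp.2 hq.2
    (sum_blockKernel_sq_le hk hn hJ1 hp.1 hp.1 hp2 hp2)
    (sum_blockKernel_sq_le hk hn hJ1 hp.1 hq.1 hp2 hq2)
    (sum_blockKernel_sq_le hk hn hJ1 hq.1 hp.1 hq2 hp2)
    (sum_blockKernel_sq_le hk hn hJ1 hq.1 hq.1 hq2 hq2)
  rw [← hFsq] at hH
  have htest := pairStat_test (m := m) (w := jointWeight p q) (fun a => mul_nonneg (hp.1 a.1) (hq.1 a.2))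
    (sum_jointWeight hp.2 hq.2) (diffFeature J) hF0 hτ0 hH hmτ
  have herr := majorityTester_error (m := m) N
    (fun z => pairStat (diffFeature J) z.1 z.2 < (m : ℝ) ^ 2 * τ / 2) hp.1 hq.1 hp.2 hq.2
  rw [sum_meanVec_sq J hp.2 hq.2] at htest
  refine ⟨fun hpq => herr.1 ?_, fun hlt => herr.2 ?_⟩
  · convert htest.1 ?_ using 1
    subst hpq
    simp [energy, blockMass]
  · convert htest.2 ?_ using 1
    obtain ⟨I, hI, hlt'⟩ := exists_partition_of_lt_akDist hε hlt
    have h := sq_sum_abs_le_energy (p - q) I hI hJ2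
    have h2 : ε ^ 2 ≤ (∑ j, |∑ x ∈ I j, (p - q) x|) ^ 2 := pow_le_pow_left₀ hε.le hlt'.le 2
    rw [hτ, div_le_iff₀ (by positivity)]
    linarith

theorem three_quarters_pow_le {δ : ℝ} (hδ : 0 < δ) {N : ℕ}
    (hN : Real.log (1 / δ) / Real.log (4 / 3) ≤ N) : (3 / 4 : ℝ) ^ N ≤ δ := by
  have hl : 0 < Real.log (4 / 3) := Real.log_pos (by norm_num)
  rw [div_le_iff₀ hl, ← Real.log_pow, Real.log_le_log_iff (by positivity) (by positivity),
    div_le_iff₀ hδ] at hN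
  have h : (3 / 4 : ℝ) ^ N * (4 / 3) ^ N = 1 := by
    rw [← mul_pow]
    norm_num
  have h0 : (0 : ℝ) ≤ (3 / 4) ^ N := by positivity
  nlinarith [mul_le_mul_of_nonneg_left hN h0]

end AkTesting

open AkTesting in
theorem mainTheorem6 (B : ℝ) :
    ∃ C : ℝ, 0 < C ∧
      ∀ (n k : ℕ) (ε δ : ℝ), 2 ≤ k → k ≤ n → 0 < ε → 0 < δ → δ < 1 →
        ∃ (m : ℕ) (T : AkTesting.Tester n m),
          (m : ℝ) ≤ C * (√(k : ℝ) / ε ^ 2 * Real.log (1 / δ)) ∧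
          ∀ p ∈ stdSimplex ℝ (Fin n), ∀ q ∈ stdSimplex ℝ (Fin n),
            AkTesting.l2Norm p ≤ B / √(n : ℝ) →
            AkTesting.l2Norm q ≤ B / √(n : ℝ) →
              (p = q → 1 - δ ≤ AkTesting.probYes T p q) ∧
              (ε < AkTesting.akDist k p q → 1 - δ ≤ AkTesting.probNo T p q) := by
  -- `B` may be zero or negative; enlarging it weakens the norm hypotheses and makes the constants
  -- positive.
  set b := max B 1
  have hb1 : 1 ≤ b := le_max_right _ _
  have hb : 0 < b := zero_lt_one.trans_le hb1
  have hl : 0 < Real.log (4 / 3) := Real.log_pos (by norm_num)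
  refine ⟨8 * 65536 * b / Real.log (4 / 3), by positivity,
    fun n k ε δ hk hkn hε hδ hδ1 => ?_⟩
  have hlog : 0 ≤ Real.log (1 / δ) := Real.log_nonneg ((one_le_div hδ).2 hδ1.le)
  have hbound : ((0 : ℕ) : ℝ) ≤ 8 * 65536 * b / Real.log (4 / 3) *
      (√(k : ℝ) / ε ^ 2 * Real.log (1 / δ)) := by
    rw [Nat.cast_zero]
    positivity
  -- As `δ` tends to 1 the budget drops below one sample, but a fair coin already suffices for `δ ≥
  -- 1 / 2`.
  rcases le_or_gt (1 / 2) δ with hδ2 | hδ2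
  · refine ⟨0, fun _ _ => ⟨1 / 2, by norm_num, by norm_num⟩, hbound, fun p hp q hq _ _ => ?_⟩
    have h1 := probYes_const (m := 0) ⟨1 / 2, by norm_num, by norm_num⟩ hp.2 hq.2
    have h2 := probYes_add_probNo (m := 0)
      (fun _ _ => ⟨1 / 2, by norm_num, by norm_num⟩) hp.2 hq.2
    constructor <;> intro _ <;> simp only at h1 h2 ⊢ <;> linarith
  -- For `ε > 2` the far case is void and YES needs no samples. Otherwise `X` and `Y` are at least
  -- 1, so rounding up at most doubles each; with two batches per run this gives the factor 8 in the
  -- constant.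
  rcases lt_or_ge 2 ε with hε2 | hε2
  · refine ⟨0, fun _ _ => 1, hbound, fun p hp q hq _ _ => ⟨fun _ => ?_, fun h => ?_⟩⟩
    · rw [probYes_const 1 hp.2 hq.2, Set.Icc.coe_one]
      linarith
    · linarith [akDist_le_two (k := k) hp hq]
  set X : ℝ := 65536 * b * √k / ε ^ 2 with hX
  set Y : ℝ := Real.log (1 / δ) / Real.log (4 / 3) with hY
  have hX1 : 1 ≤ X := by
    have hs : 1 ≤ √(k : ℝ) := Real.one_le_sqrt.2 (by exact_mod_cast one_le_two.trans hk)
    rw [hX, one_le_div (by positivity)]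
    nlinarith [one_le_mul_of_one_le_of_one_le hb1 hs]
  have hY1 : 1 ≤ Y := by
    rw [hY, one_le_div hl]
    refine Real.log_le_log (by norm_num) ?_
    rw [le_div_iff₀ hδ]
    linarith
  obtain ⟨T, hT⟩ := exists_majority_tester (m := ⌈X⌉₊) ⌈Y⌉₊ (two_pos.trans_le hk) hkn hb hε
    (Nat.le_ceil X)
  refine ⟨_, T, ?_, fun p hp q hq hp2 hq2 => ?_⟩
  · have h1 : (⌈X⌉₊ : ℝ) ≤ 2 * X := by linarith [Nat.ceil_lt_add_one (zero_le_one.trans hX1)]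
    have h2 : (⌈Y⌉₊ : ℝ) ≤ 2 * Y := by linarith [Nat.ceil_lt_add_one (zero_le_one.trans hY1)]
    push_cast
    calc (⌈Y⌉₊ : ℝ) * (⌈X⌉₊ + ⌈X⌉₊) ≤ (2 * Y) * (2 * X + 2 * X) := by gcongr
      _ = _ := by
        rw [hX, hY]
        ring
  · have hle : B / √(n : ℝ) ≤ b / √(n : ℝ) := by
      gcongr
      exact le_max_left _ _
    have h := hT p hp q hq (sum_sq_le_of_l2Norm_le (hp2.trans hle))
      (sum_sq_le_of_l2Norm_le (hq2.trans hle))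
    have hsum := probYes_add_probNo T hp.2 hq.2
    have hpow := three_quarters_pow_le hδ (Nat.le_ceil Y)
    exact ⟨fun hpq => by linarith [h.1 hpq], fun hlt => by linarith [h.2 hlt]⟩
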